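/- Conventions: all rings are commutative and Noetherian and all modules are finitely generated. For a ring $A$, $\operatorname{CM}(A)$ is the class of maximal Cohen–Macaulay $A$-modules, i.e. modules $M$ with $\operatorname{depth}_{A_{\mathfrak m}} M_{\mathfrak m}\ge \dim A_{\mathfrak m}$ for every maximal ideal $\mathfrak m$ (the zero module is included); $\operatorname{refl}(A)$ is the class of reflexive $A$-modules; $\Omega\operatorname{CM}(A)$ is the class of $A$-modules $M$ for which there is an exact sequence $0\to M\to P\to N\to 0$ with $P$ projective and $N\in\operatorname{CM}(A)$; $\operatorname{tr}_A(M)=\sum_{f\in \operatorname{Hom}_A(M,A)} f(M)$. An ideal $I$ of $A$ is stable if it contains a non-zero-divisor and $I\cong\operatorname{Hom}_A(I,I)$ as $A$-modules. $A$ is generically Gorenstein if $A_{\mathfrak p}$ is Gorenstein for every associated prime $\mathfrak p$ of $A$. Theorem. Let $R$ be a generically Gorenstein Cohen–Macaulay local ring of dimension $1$ with total ring of fractions $Q(R)$, and let $R\subseteq S\subseteq Q(R)$ be a ring extension such that $S$ is a finitely generated $R$-module. Let $\mathfrak c_R(S)=\{a\in Q(R): aS\subseteq R\}$, which is an ideal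 of $R$. Then the following are equivalent: (1) $\Omega\operatorname{CM}(S)=\operatorname{CM}(S)\cap\Omega\operatorname{CM}(R)$, i.e. an $S$-module $M$ is in $\Omega\operatorname{CM}(S)$ if and only if it is in $\operatorname{CM}(S)$ and, as an $R$-module, in $\Omega\operatorname{CM}(R)$; (2) $S\cong\operatorname{Hom}_R(S,R)$ as $R$-modules; (3) $S\in\operatorname{refl}(R)$, and $\mathfrak c_R(S)$ is a stable ideal of $R$; (4) $\Omega\operatorname{CM}(S)=\{M\in\operatorname{refl}(R):\operatorname{tr}_R(M)\subseteq\mathfrak c_R(S)\}$ as classes of $R$-modules, i.e. an $R$-module $M$ is reflexive over $R$ with $\operatorname{tr}_R(M)\subseteq\mathfrak c_R(S)$ if and only if its $R$-module structure extends to an $S$-module structure for which $M\in\Omega\operatorname{CM}(S)$; (5) $\operatorname{refl}(S)=\operatorname{CM}(S)\cap\operatorname{refl}(R)$, i.e. an $S$-module $M$ is in $\operatorname{refl}(S)$ if and only if it is in $\operatorname{CM}(S)$ and, as an $R$-module, in $\operatorname{refl}(R)$. Moreover, $\Omega\operatorname{CM}(R)=\operatorname{refl}(R)$ and $\Omega\operatorname{CM}(S)=\operatorname{refl}(S)$.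 -/

import Mathlib

universe u

/-- A module `M` over a local ring `A` has depth at least `dim A`: some sequence of `dim A` elements
of the maximal ideal is weakly `M`-regular. For a finitely generated nonzero `M` weak regularity is
regularity by Nakayama's lemma; the zero module has infinite depth and is included. -/
def HasMaximalDepth (A : Type u) [CommRing A] [IsLocalRing A] (M : Type u) [AddCommGroup M]
    [Module A M] : Prop :=
  ∃ rs : List A, (∀ r ∈ rs, r ∈ IsLocalRing.maximalIdeal A) ∧
    RingTheory.Sequence.IsWeaklyRegular M rs ∧ (rs.length : WithBot ℕ∞) = ringKrullDim A

/-- A local ring is Cohen–Macaulay if it is Noetherian and its depth equals its dimension. -/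
def IsCohenMacaulayLocal (A : Type u) [CommRing A] [IsLocalRing A] : Prop :=
  IsNoetherianRing A ∧ HasMaximalDepth A A

/-- A ring is Gorenstein, in the sense used for Noetherian local rings: it has finite injective
dimension as a module over itself. -/
def IsGorensteinLocal (A : Type u) [CommRing A] : Prop :=
  ∃ n : ℕ, CategoryTheory.HasInjectiveDimensionLE (ModuleCat.of A A) n

/-- The localizations at all associated primes of the ring are Gorenstein. -/
def IsGenericallyGorenstein (A : Type u) [CommRing A] : Prop :=
  ∀ (p : Ideal A) [p.IsPrime], p ∈ associatedPrimes A A →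
    IsGorensteinLocal (Localization.AtPrime p)

/-- `M ∈ CM(A)`: `M` is finitely generated and `depth M_𝔪 ≥ dim A_𝔪` for all maximal ideals `𝔪`. -/
def IsMCM (A : Type u) [CommRing A] (M : Type u) [AddCommGroup M] [Module A M] : Prop :=
  Module.Finite A M ∧ ∀ (m : Ideal A) [m.IsMaximal],
    HasMaximalDepth (Localization.AtPrime m) (LocalizedModule m.primeCompl M)

/-- `M ∈ ΩCM(A)`: there is an exact sequence `0 → M → P → N → 0` with `P` finitely generated
projective and `N ∈ CM(A)`. -/
def IsSyzygyMCM (A : Type u) [CommRing A] (M : Type u) [AddCommGroup M] [Module A M] : Prop :=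
  Module.Finite A M ∧
    ∃ (P N : Type u) (_ : AddCommGroup P) (_ : Module A P) (_ : AddCommGroup N) (_ : Module A N)
      (f : M →ₗ[A] P) (g : P →ₗ[A] N),
      Module.Finite A P ∧ Module.Projective A P ∧ IsMCM A N ∧
        Function.Injective f ∧ Function.Exact f g ∧ Function.Surjective g

/-- `M ∈ refl(A)`: `M` is finitely generated and the canonical map to its bidual is bijective. -/
def IsReflModule (A : Type u) [CommRing A] (M : Type u) [AddCommGroup M] [Module A M] : Prop :=
  Module.Finite A M ∧ Module.IsReflexive A M

/-- The trace ideal: the sum of the images of all linear maps `M → A`. -/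
def moduleTrace (A : Type u) [CommRing A] (M : Type u) [AddCommGroup M] [Module A M] : Ideal A :=
  ⨆ f : Module.Dual A M, LinearMap.range f

/-- The conductor `(R :_Q S) = {a ∈ Q | a S ⊆ R}`, viewed as an ideal of `R`
(it lies in the image of `R` in `Q` because `1 ∈ S`). -/
def birationalConductor {R Q : Type u} [CommRing R] [CommRing Q] [Algebra R Q]
    (S : Subalgebra R Q) : Ideal R :=
  Submodule.comap (Algebra.linearMap R Q) ((1 : Submodule R Q) / Subalgebra.toSubmodule S)

/-- A stable ideal: it contains a non-zero-divisor and `I ≅ Hom_A(I, I)`. -/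
def IsStableIdeal {A : Type u} [CommRing A] (I : Ideal A) : Prop :=
  (∃ x ∈ I, x ∈ nonZeroDivisors A) ∧ Nonempty (I ≃ₗ[A] (I →ₗ[A] I))

/-
`R` is generically Gorenstein, so `Q` is self-injective. Hence every linear form on a submodule of
a projective module over `R` or `S` extends up to a regular factor, which makes syzygies of maximal
Cohen–Macaulay modules reflexive.

The dual `Hom_R(S, R)` is the conductor `C = (R :_Q S)`. An isomorphism `S ≅ Hom_R(S, R)` is the
trace form `(s, u) ↦ t (s * u)` of the image `t` of `1`, and `f ↦ t ∘ f` then identifies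
`Hom_S(M, S)` with `Hom_R(M, R)`, so that `M` is reflexive over `S` iff it is over `R`. Conversely,
if `S` is reflexive over `R`, then `(C :_Q C) = S`; if moreover `C` is reflexive over `S`, then
`C * (S :_Q C)` has `S`-dual inside `S`, which in dimension one forces it to be `S`. Thus `C` is
invertible over the semilocal ring `S`, and `C ≅ S`.
-/

open scoped nonZeroDivisors

section SelfInjective

open CategoryTheory Abelian

lemma subsingleton_ext_of_mono_projective {C : Type*} [Category C] [Abelian C] [HasExt C]
    {X Y P : C} [Projective P] (i : Y ⟶ P) [Mono i] (n : ℕ) [HasInjectiveDimensionLT X (n + 2)] :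
    Subsingleton (Ext Y X (n + 1)) := by
  have hT : (ShortComplex.mk i (Limits.cokernel.π i) (Limits.cokernel.condition i)).ShortExact :=
    { exact := ShortComplex.exact_cokernel i }
  refine subsingleton_of_forall_eq 0 fun e => ?_
  obtain ⟨e', rfl⟩ := Ext.contravariant_sequence_exact₁ hT X e (add_comm 1 _)
    (Ext.eq_zero_of_hasInjectiveDimensionLT _ (n + 2) le_rfl)
  rw [Ext.eq_zero_of_projective e', Ext.comp_zero]

lemma subsingleton_ext_of_shortExact {C : Type*} [Category C] [Abelian C] [HasExt C]
    {T : ShortComplex C} (hT : T.ShortExact) (X : C) (n : ℕ) [Subsingleton (Ext T.X₁ X n)]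
    [Subsingleton (Ext T.X₃ X n)] : Subsingleton (Ext T.X₂ X n) :=
  subsingleton_of_forall_eq 0 fun e => by
    obtain ⟨e', rfl⟩ := Ext.contravariant_sequence_exact₂ hT X e (Subsingleton.elim _ _)
    rw [Subsingleton.elim e' 0, Ext.comp_zero]

lemma subsingleton_ext_of_pow_le_annihilator {A : Type u} [CommRing A] (I : Ideal A)
    (X : ModuleCat.{u} A) (n : ℕ)
    (hI : ∀ Y : ModuleCat.{u} A, I ≤ Module.annihilator A Y → Subsingleton (Ext.{u} Y X n))
    (k : ℕ) (Y : ModuleCat.{u} A) (hY : I ^ k ≤ Module.annihilator A Y) :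
    Subsingleton (Ext.{u} Y X n) := by
  induction k generalizing Y with
  | zero => exact hI Y (le_top.trans (by simpa using hY))
  | succ k ih =>
    let K : Submodule A Y := I • ⊤
    have hK : I ^ k ≤ Module.annihilator A (LinearMap.ker K.mkQ) := by
      change I ^ k ≤ (LinearMap.ker K.mkQ).annihilator
      rwa [K.ker_mkQ, Submodule.le_annihilator_iff, ← mul_smul, ← pow_succ,
        ← Submodule.le_annihilator_iff, Submodule.annihilator_top]
    have hYK : I ≤ Module.annihilator A (Y ⧸ K) :=
      (Module.isTorsionBySet_iff_subset_annihilator _ _).1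
        (Module.isTorsionBySet_quotient_ideal_smul Y I)
    have := ih (.of A (LinearMap.ker K.mkQ)) hK
    have := hI (.of A (Y ⧸ K)) hYK
    exact subsingleton_ext_of_shortExact
      (LinearMap.shortExact_shortComplexKer K.mkQ_surjective) X n

lemma exists_quotient_maximalIdeal_injective (A : Type u) [CommRing A] [IsLocalRing A]
    [IsArtinianRing A] :
    ∃ g : (A ⧸ IsLocalRing.maximalIdeal A) →ₗ[A] A, Function.Injective g := by
  obtain ⟨p, hp⟩ := associatedPrimes.nonempty A A
  have := IsAssociatedPrime.isPrime hp
  obtain rfl : p = IsLocalRing.maximalIdeal A := IsLocalRing.eq_maximalIdeal inferInstance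
  exact (isAssociatedPrime_iff_exists_injective_linearMap ..).1 hp |>.2

lemma exists_injective_finsupp_of_maximalIdeal_le_annihilator {A : Type u} [CommRing A]
    [IsLocalRing A] [IsArtinianRing A] (Y : Type u) [AddCommGroup Y] [Module A Y]
    (hY : IsLocalRing.maximalIdeal A ≤ Module.annihilator A Y) :
    ∃ (ι : Type u) (f : Y →ₗ[A] (ι →₀ A)), Function.Injective f := by
  let m := IsLocalRing.maximalIdeal A
  let _ : Field (A ⧸ m) := Ideal.Quotient.field m
  have htor : Module.IsTorsionBySet A Y (m : Set A) :=
    (Module.isTorsionBySet_iff_subset_annihilator _ _).2 hY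
  let _ : Module (A ⧸ m) Y := htor.module
  have : IsScalarTower A (A ⧸ m) Y := htor.isScalarTower
  let b := Module.Basis.ofVectorSpace (A ⧸ m) Y
  obtain ⟨g, hg⟩ := exists_quotient_maximalIdeal_injective A
  exact ⟨_, Finsupp.mapRange.linearMap g ∘ₗ b.repr.toLinearMap.restrictScalars A,
    (Finsupp.mapRange_injective _ (map_zero g) hg).comp b.repr.injective⟩

lemma hasInjectiveDimensionLT_of_isArtinianRing (A : Type u) [CommRing A] [IsLocalRing A]
    [IsArtinianRing A] (X : ModuleCat.{u} A) (n : ℕ) [HasInjectiveDimensionLT X (n + 2)] :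
    HasInjectiveDimensionLT X (n + 1) := by
  obtain ⟨k, hk⟩ := (isArtinianRing_iff_isNilpotent_maximalIdeal A).1 inferInstance
  refine hasInjectiveDimensionLT_of_enoughProjectives.{u} X _ fun Y =>
    subsingleton_ext_of_pow_le_annihilator (IsLocalRing.maximalIdeal A) X _ (fun Z hZ => ?_) k Y
      (by rw [hk]; exact bot_le)
  obtain ⟨ι, f, hf⟩ := exists_injective_finsupp_of_maximalIdeal_le_annihilator Z hZ
  have : Mono (ModuleCat.ofHom f) := (ModuleCat.mono_iff_injective _).2 hf
  exact subsingleton_ext_of_mono_projective (ModuleCat.ofHom f) n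

theorem IsGorensteinLocal.injective_of_isArtinianRing {A : Type u} [CommRing A] [IsLocalRing A]
    [IsArtinianRing A] (hA : IsGorensteinLocal A) : Module.Injective A A := by
  obtain ⟨n, hn⟩ := hA
  have : HasInjectiveDimensionLT (ModuleCat.of A A) 1 := by
    induction n with
    | zero => exact hn
    | succ n ih =>
      have : HasInjectiveDimensionLT (ModuleCat.of A A) (n + 2) := hn
      exact ih (hasInjectiveDimensionLT_of_isArtinianRing A _ n)
  have := injective_iff_hasInjectiveDimensionLT_one.2 this
  exact Module.injective_module_of_injective_object A A

end SelfInjective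

lemma hasMaximalDepth_iff_exists_isSMulRegular {A : Type u} [CommRing A] [IsLocalRing A]
    (hdim : ringKrullDim A = 1) (M : Type u) [AddCommGroup M] [Module A M] :
    HasMaximalDepth A M ↔ ∃ r ∈ IsLocalRing.maximalIdeal A, IsSMulRegular M r := by
  constructor
  · rintro ⟨rs, hmem, hreg, hlen⟩
    obtain ⟨r, rfl⟩ := List.length_eq_one_iff.1 (by exact_mod_cast hlen.trans hdim)
    exact ⟨r, hmem r (List.mem_singleton_self r),
      (RingTheory.Sequence.isWeaklyRegular_singleton_iff M r).1 hreg⟩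
  · rintro ⟨r, hmem, hreg⟩
    exact ⟨[r], by simpa using hmem,
      (RingTheory.Sequence.isWeaklyRegular_singleton_iff M r).2 hreg, by simp [hdim]⟩

/-- Cohen–Macaulay rings all of whose maximal ideals have height one, encoded by the equivalent
condition that a prime ideal of the Noetherian ring `A` is maximal if and only if it contains a
regular element. -/
class IsOneDimCohenMacaulay (A : Type u) [CommRing A] : Prop extends IsNoetherianRing A where
  isMaximal_iff (p : Ideal A) [p.IsPrime] : p.IsMaximal ↔ ∃ x ∈ p, IsRegular x

lemma IsCohenMacaulayLocal.isOneDimCohenMacaulay {A : Type u} [CommRing A] [IsLocalRing A]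
    (hA : IsCohenMacaulayLocal A) (hdim : ringKrullDim A = 1) : IsOneDimCohenMacaulay A where
  __ := hA.1
  isMaximal_iff p hp := by
    constructor
    · intro hmax
      obtain ⟨r, hr, hreg⟩ := (hasMaximalDepth_iff_exists_isSMulRegular hdim A).1 hA.2
      exact ⟨r, IsLocalRing.eq_maximalIdeal hmax ▸ hr,
        isLeftRegular_iff_isRegular.1 hreg⟩
    · rintro ⟨x, hxp, hx⟩
      have : Ring.KrullDimLE 1 A := Ring.krullDimLE_iff.2 hdim.le
      refine (Ring.krullDimLE_one_iff.1 this p hp).resolve_left fun hmin => ?_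
      exact (Ideal.disjoint_nonZeroDivisors_of_mem_minimalPrimes hmin).le_bot
        ⟨hxp, hx.mem_nonZeroDivisors⟩

namespace IsOneDimCohenMacaulay

variable {A : Type u} [CommRing A] [IsOneDimCohenMacaulay A]

lemma notMem_minimalPrimes (n : Ideal A) [n.IsMaximal] : n ∉ minimalPrimes A := fun hn =>
  have ⟨_, hxn, hx⟩ := (isMaximal_iff n).1 inferInstance
  (Ideal.disjoint_nonZeroDivisors_of_mem_minimalPrimes hn).le_bot ⟨hxn, hx.mem_nonZeroDivisors⟩

lemma mem_minimalPrimes_span_singleton {n : Ideal A} [hn : n.IsMaximal] {x : A} (hxn : x ∈ n)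
    (hx : IsRegular x) : n ∈ (Ideal.span {x}).minimalPrimes := by
  refine ⟨⟨hn.isPrime, (Ideal.span_singleton_le_iff_mem _).2 hxn⟩, fun q ⟨_, hxq⟩ hqn => ?_⟩
  have hq := (isMaximal_iff q).2 ⟨x, (Ideal.span_singleton_le_iff_mem _).1 hxq, hx⟩
  exact (hq.eq_of_le hn.ne_top hqn).ge

lemma height_eq_one (n : Ideal A) [n.IsMaximal] : n.height = 1 := by
  obtain ⟨x, hxn, hx⟩ := (isMaximal_iff n).1 inferInstance
  refine le_antisymm (Ideal.height_le_one_of_isPrincipal_of_mem_minimalPrimes _ n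
    (mem_minimalPrimes_span_singleton hxn hx)) ?_
  rw [Order.one_le_iff_ne_zero, Ne, Ideal.height_eq_zero_iff]
  exact notMem_minimalPrimes n

lemma ringKrullDim_localization (n : Ideal A) [n.IsMaximal] :
    ringKrullDim (Localization.AtPrime n) = 1 := by
  rw [IsLocalization.AtPrime.ringKrullDim_eq_height n, height_eq_one n]; rfl

lemma mem_minimalPrimes_of_forall_not_isRegular {p : Ideal A} [hp : p.IsPrime]
    (h : ∀ x ∈ p, ¬ IsRegular x) : p ∈ minimalPrimes A := by
  obtain ⟨n, hn, hpn⟩ := Ideal.exists_le_maximal p hp.ne_top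
  have hlt : p < n := hpn.lt_of_ne fun e => by
    obtain ⟨x, hxp, hx⟩ := (isMaximal_iff p).1 (e ▸ hn)
    exact h x hxp hx
  rw [← Ideal.height_eq_zero_iff, ← Order.lt_one_iff, ← height_eq_one n]
  exact Ideal.height_strict_mono_of_isPrime_of_isPrime hlt

lemma maximalIdeal_le_radical_span_singleton (n : Ideal A) [hn : n.IsMaximal] {x : A}
    (hx : IsRegular x) :
    IsLocalRing.maximalIdeal (Localization.AtPrime n) ≤
      (Ideal.span {algebraMap A (Localization.AtPrime n) x}).radical := by
  rw [Ideal.radical_eq_sInf]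
  refine le_sInf fun P ⟨hxP, _⟩ => ?_
  have hmax : (P.under A).IsMaximal :=
    (isMaximal_iff _).2 ⟨x, hxP (Ideal.mem_span_singleton_self _), hx⟩
  have hle : P.under A ≤ n := (Ideal.comap_mono (IsLocalRing.le_maximalIdeal_of_isPrime P)).trans
    (IsLocalization.AtPrime.under_maximalIdeal _ n).le
  exact (Localization.AtPrime.eq_maximalIdeal_iff_under_eq.1 (hmax.eq_of_le hn.ne_top hle)).ge

lemma isSMulRegular_of_hasMaximalDepth (n : Ideal A) [n.IsMaximal] {N : Type u} [AddCommGroup N]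
    [Module A N] [Module (Localization.AtPrime n) N] [IsScalarTower A (Localization.AtPrime n) N]
    (hN : HasMaximalDepth (Localization.AtPrime n) N) {x : A} (hx : IsRegular x) :
    IsSMulRegular N x := by
  obtain ⟨r, hr, hreg⟩ :=
    (hasMaximalDepth_iff_exists_isSMulRegular (ringKrullDim_localization n) N).1 hN
  obtain ⟨k, hk⟩ := maximalIdeal_le_radical_span_singleton n hx hr
  obtain ⟨c, hc⟩ := Ideal.mem_span_singleton'.1 hk
  refine .of_right_eq_zero_of_smul fun z hz => (hreg.pow k).right_eq_zero_of_smul ?_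
  rw [← hc, mul_smul, algebraMap_smul, hz, smul_zero]

lemma hasMaximalDepth_localizedModule (n : Ideal A) [n.IsMaximal] (M : Type u) [AddCommGroup M]
    [Module A M] [Module.IsTorsionFree A M] :
    HasMaximalDepth (Localization.AtPrime n) (LocalizedModule n.primeCompl M) := by
  obtain ⟨x, hxn, hx⟩ := (isMaximal_iff n).1 inferInstance
  rw [hasMaximalDepth_iff_exists_isSMulRegular (ringKrullDim_localization n)]
  refine ⟨algebraMap A _ x, ?_, (hx.isSMulRegular (M := M)).of_isLocalizedModule
    (Localization.AtPrime n) n.primeCompl (LocalizedModule.mkLinearMap n.primeCompl M)⟩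
  rwa [← IsLocalization.AtPrime.under_maximalIdeal (Localization.AtPrime n) n] at hxn

theorem isMCM_iff (M : Type u) [AddCommGroup M] [Module A M] :
    IsMCM A M ↔ Module.Finite A M ∧ Module.IsTorsionFree A M := by
  refine and_congr_right fun _ => ⟨fun hM => ⟨fun x hx => ?_⟩, fun _ n _ =>
    hasMaximalDepth_localizedModule n M⟩
  refine .of_right_eq_zero_of_smul fun z hz => Module.eq_zero_of_localization_maximal (R := A)
    (fun n _ => LocalizedModule n.primeCompl M)
    (fun n _ => LocalizedModule.mkLinearMap n.primeCompl M) z fun n _ => ?_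
  exact (isSMulRegular_of_hasMaximalDepth n (hM n) hx).right_eq_zero_of_smul
    (by rw [← map_smul, hz, map_zero])

end IsOneDimCohenMacaulay

section InjectiveFractionRing

variable {A Q : Type u} [CommRing A] [CommRing Q] [Algebra A Q] [IsFractionRing A Q]

theorem IsGenericallyGorenstein.injective_fractionRing [IsOneDimCohenMacaulay A]
    (hA : IsGenericallyGorenstein A) : Module.Injective Q Q := by
  have : IsNoetherianRing Q := IsLocalization.isNoetherianRing A⁰ Q inferInstance
  refine Module.injective_of_localization_maximal' (R := Q) (M := Q)
    (fun (P : Ideal Q) _ => Localization.AtPrime P) (fun (P : Ideal Q) _ => Localization.AtPrime P)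
    (fun (P : Ideal Q) _ => Algebra.linearMap Q (Localization.AtPrime P)) fun P hP => ?_
  let p : Ideal A := P.under A
  have hp : p ∈ minimalPrimes A :=
    IsOneDimCohenMacaulay.mem_minimalPrimes_of_forall_not_isRegular fun x hxp hx =>
      hP.ne_top (Ideal.eq_top_of_isUnit_mem _ hxp
        (IsLocalization.map_units Q (⟨x, hx.mem_nonZeroDivisors⟩ : A⁰)))
  have hass : p ∈ associatedPrimes A A :=
    Module.associatedPrimes.minimalPrimes_annihilator_subset_associatedPrimes A A
      (by rwa [Module.annihilator_eq_bot.2 inferInstance])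
  have : IsArtinianRing (Localization.AtPrime p) := by
    rw [isArtinianRing_iff_isNoetherianRing_krullDimLE_zero, Ring.krullDimLE_iff,
      IsLocalization.AtPrime.ringKrullDim_eq_height p, Ideal.height_eq_zero_iff.2 hp]
    exact ⟨inferInstance, le_rfl⟩
  have := (hA p hass).injective_of_isArtinianRing
  have : IsLocalization.AtPrime (Localization.AtPrime P) p :=
    IsLocalization.isLocalization_isLocalization_atPrime_isLocalization A⁰
      (Localization.AtPrime P) P
  let e : Localization.AtPrime p ≃+* Localization.AtPrime P :=
    (IsLocalization.algEquiv p.primeCompl (Localization.AtPrime p)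
      (Localization.AtPrime P)).toRingEquiv
  exact .of_ringEquiv e e.toSemilinearEquiv

omit [IsFractionRing A Q] in
lemma injective_of_flat_of_injective [Module.Flat A Q] [Module.Injective Q Q] :
    Module.Injective A Q where
  out X Y _ _ _ _ f hf g := by
    obtain ⟨l, hl⟩ := Module.Injective.out (R := Q) (f.baseChange Q)
      (Module.Flat.lTensor_preserves_injective_linearMap f hf) (g.liftBaseChange Q)
    refine ⟨l.restrictScalars A ∘ₗ TensorProduct.mk A Q Y 1, fun z => ?_⟩
    simpa using hl (1 ⊗ₜ z)

variable [IsNoetherianRing A] [Module.Injective A Q]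

variable (Q)

include Q

lemma exists_comp_eq_smul_of_injective {M P : Type u} [AddCommGroup M] [Module A M]
    [AddCommGroup P] [Module A P] [Module.Finite A P] (i : M →ₗ[A] P) (hi : Function.Injective i)
    (f : Module.Dual A M) : ∃ d : A⁰, ∃ f' : Module.Dual A P, f' ∘ₗ i = d • f := by
  obtain ⟨g, hg⟩ := Module.Injective.out (R := A) i hi (Algebra.linearMap A Q ∘ₗ f)
  have := Module.finitePresentation_of_finite A P
  obtain ⟨f', d, hf'⟩ := Module.FinitePresentation.exists_lift_of_isLocalizedModule A⁰
    (Algebra.linearMap A Q) g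
  refine ⟨d, f', LinearMap.ext fun z => IsFractionRing.injective A Q ?_⟩
  have hz : algebraMap A Q (f' (i z)) = d • g (i z) := LinearMap.congr_fun hf' (i z)
  rw [LinearMap.comp_apply, hz, hg]
  exact (map_smul (Algebra.linearMap A Q) (d : A) (f z)).symm

lemma exists_dual_apply_ne_zero {N : Type u} [AddCommGroup N] [Module A N] [Module.Finite A N]
    [Module.IsTorsionFree A N] {z : N} (hz : z ≠ 0) : ∃ f : Module.Dual A N, f z ≠ 0 := by
  let t : A →ₗ[A] N := LinearMap.toSpanSingleton A N z
  have hdisj : Disjoint (LinearMap.ker t : Set A) A⁰ :=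
    Set.disjoint_left.2 fun x hxz hx => hz <|
      (isRegular_iff_mem_nonZeroDivisors.2 hx).isSMulRegular.right_eq_zero_of_smul hxz
  obtain ⟨-, a, ha, ha0⟩ := SetLike.lt_iff_le_and_exists.1
    (Ideal.bot_lt_annihilator_of_disjoint_nonZeroDivisors hdisj)
  let g : (A ⧸ LinearMap.ker t) →ₗ[A] A :=
    (LinearMap.ker t).liftQ (LinearMap.toSpanSingleton A A a) fun r hr =>
      (mul_comm r a).trans (Submodule.mem_annihilator.1 ha r hr)
  let i : (A ⧸ LinearMap.ker t) →ₗ[A] N := (LinearMap.ker t).liftQ t le_rfl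
  have hi : Function.Injective i := LinearMap.ker_eq_bot.1 (Submodule.ker_liftQ_eq_bot' _ _ rfl)
  obtain ⟨d, f, hf⟩ := exists_comp_eq_smul_of_injective Q i hi g
  refine ⟨f, fun hfz => ha0 ?_⟩
  have hiz : i (Submodule.Quotient.mk 1) = z := one_smul A z
  have hga : g (Submodule.Quotient.mk 1) = a := one_smul A a
  have hda := LinearMap.congr_fun hf (Submodule.Quotient.mk 1)
  rw [LinearMap.comp_apply, hiz, hfz, LinearMap.smul_apply, hga] at hda
  exact (mul_left_mem_nonZeroDivisors_eq_zero_iff d.2).1 hda.symm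

lemma injective_dual_eval_of_isTorsionFree (N : Type u) [AddCommGroup N] [Module A N]
    [Module.Finite A N] [Module.IsTorsionFree A N] : Function.Injective (Module.Dual.eval A N) := by
  refine (injective_iff_map_eq_zero _).2 fun z hz => by_contra fun hz0 => ?_
  obtain ⟨f, hf⟩ := exists_dual_apply_ne_zero (A := A) Q hz0
  exact hf (LinearMap.congr_fun hz f)

lemma isReflexive_of_exact_of_isTorsionFree {M P N : Type u} [AddCommGroup M] [Module A M]
    [AddCommGroup P] [Module A P] [AddCommGroup N] [Module A N] [Module.Finite A P]
    [Module.IsReflexive A P] [Module.Finite A N] [Module.IsTorsionFree A N] {i : M →ₗ[A] P}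
    {g : P →ₗ[A] N} (hi : Function.Injective i) (hig : Function.Exact i g) :
    Module.IsReflexive A M := by
  have : Module.Finite A M := .of_injective i hi
  have : Module.IsTorsionFree A M := hi.moduleIsTorsionFree i (map_smul i)
  refine ⟨injective_dual_eval_of_isTorsionFree Q M, fun φ => ?_⟩
  obtain ⟨p, hp⟩ := (Module.bijective_dual_eval A P).2 (φ ∘ₗ i.dualMap)
  have hφ (f : Module.Dual A P) : f p = φ (f ∘ₗ i) := LinearMap.congr_fun hp f
  have hgp : g p = 0 := injective_dual_eval_of_isTorsionFree Q N <| LinearMap.ext fun f => by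
    have hf := hφ (f ∘ₗ g)
    rw [LinearMap.comp_assoc, hig.linearMap_comp_eq_zero, LinearMap.comp_zero, map_zero] at hf
    rw [map_zero]
    exact hf
  obtain ⟨z, rfl⟩ := (hig p).1 hgp
  refine ⟨z, LinearMap.ext fun f => ?_⟩
  obtain ⟨d, f', hf'⟩ := exists_comp_eq_smul_of_injective Q i hi f
  have hd : d • f z = d • φ f := by
    rw [← LinearMap.smul_apply, ← hf', LinearMap.comp_apply, hφ, hf', LinearMap.map_smul_of_tower]
  exact (mul_cancel_left_mem_nonZeroDivisors d.2).1 hd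

end InjectiveFractionRing

lemma exists_eval_eq_of_ker_le_ker {A : Type u} [CommRing A] {M F : Type u} [AddCommGroup M]
    [Module A M] [Module.IsReflexive A M] [AddCommGroup F] [Module A F]
    {π : F →ₗ[A] Module.Dual A M} (hπ : Function.Surjective π) {f : Module.Dual A F}
    (hf : LinearMap.ker π ≤ LinearMap.ker f) : ∃ z : M, ∀ w, π w z = f w := by
  obtain ⟨z, hz⟩ := (Module.bijective_dual_eval A M).2
    ((LinearMap.ker π).liftQ f hf ∘ₗ (π.quotKerEquivOfSurjective hπ).symm.toLinearMap)
  refine ⟨z, fun w => (LinearMap.congr_fun hz (π w)).trans ?_⟩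
  rw [LinearMap.comp_apply, LinearEquiv.coe_coe, LinearMap.quotKerEquivOfSurjective_symm_apply]
  rfl

namespace IsOneDimCohenMacaulay

variable {A : Type u} [CommRing A] [IsOneDimCohenMacaulay A]

lemma isSyzygyMCM_of_isReflModule {M : Type u} [AddCommGroup M] [Module A M]
    (hM : IsReflModule A M) : IsSyzygyMCM A M := by
  obtain ⟨hfin, _⟩ := hM
  obtain ⟨n, π, hπ⟩ := Module.Finite.exists_fin' A (Module.Dual A M)
  let i : M →ₗ[A] Module.Dual A (Fin n → A) := π.dualMap ∘ₗ Module.Dual.eval A M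
  let ρ : Module.Dual A (Fin n → A) →ₗ[A] Module.Dual A (LinearMap.ker π) :=
    (LinearMap.ker π).subtype.dualMap
  refine ⟨hfin, Module.Dual A (Fin n → A), LinearMap.range ρ, inferInstance, inferInstance,
    inferInstance, inferInstance, i, ρ.rangeRestrict, inferInstance, inferInstance,
    (isMCM_iff _).2 ⟨inferInstance, inferInstance⟩,
    (LinearMap.dualMap_injective_of_surjective hπ).comp (Module.bijective_dual_eval A M).1,
    fun f => ⟨fun hf => ?_, ?_⟩, ρ.surjective_rangeRestrict⟩
  · have hker : LinearMap.ker π ≤ LinearMap.ker f := fun w hw =>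
      LinearMap.congr_fun (congrArg Subtype.val hf) ⟨w, hw⟩
    exact (exists_eval_eq_of_ker_le_ker hπ hker).imp fun z hz => LinearMap.ext hz
  · rintro ⟨z, rfl⟩
    exact Subtype.ext <| LinearMap.ext fun w => LinearMap.congr_fun (LinearMap.mem_ker.1 w.2) z

theorem isSyzygyMCM_iff_isReflModule (Q : Type u) [CommRing Q] [Algebra A Q] [IsFractionRing A Q]
    [Module.Injective Q Q] (M : Type u) [AddCommGroup M] [Module A M] :
    IsSyzygyMCM A M ↔ IsReflModule A M := by
  refine ⟨fun ⟨hfin, P, N, _, _, _, _, i, g, _, _, hN, hi, hig, _⟩ => ⟨hfin, ?_⟩,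
    isSyzygyMCM_of_isReflModule⟩
  obtain ⟨_, _⟩ := (isMCM_iff N).1 hN
  have : Module.Flat A Q := IsLocalization.flat Q A⁰
  have : Module.Injective A Q := injective_of_flat_of_injective
  exact isReflexive_of_exact_of_isTorsionFree Q hi hig

end IsOneDimCohenMacaulay

section TraceForm

variable {R S : Type u} [CommRing R] [CommRing S] [Algebra R S] {t : S →ₗ[R] R}
  (ht : Function.Bijective ((LinearMap.mul R S).compr₂ t))
  {M : Type u} [AddCommGroup M] [Module R M] [Module S M] [IsScalarTower R S M]

include ht in
lemma eq_of_forall_traceForm_eq {s s' : S} (h : ∀ u, t (s * u) = t (s' * u)) : s = s' :=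
  ht.1 (LinearMap.ext h)

include ht in
lemma exists_linearMap_traceForm_eq (g : Module.Dual R M) :
    ∃ f : Module.Dual S M, ∀ m, t (f m) = g m := by
  have hex (m : M) : ∃ s, ∀ u : S, t (s * u) = g (u • m) :=
    (ht.2 (g ∘ₗ (LinearMap.toSpanSingleton S M m).restrictScalars R)).imp
      fun _ => LinearMap.congr_fun
  choose σ hσ using hex
  refine ⟨{ toFun := σ, map_add' := fun m m' => ?_, map_smul' := fun s m => ?_ }, fun m => ?_⟩
  · refine eq_of_forall_traceForm_eq ht fun u => ?_
    rw [hσ, smul_add, map_add, add_mul, map_add, hσ, hσ]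
  · refine eq_of_forall_traceForm_eq ht fun u => ?_
    rw [hσ, smul_smul, ← hσ, RingHom.id_apply, smul_eq_mul]
    exact congrArg t (by ring)
  · have hm := hσ m 1
    rwa [mul_one, one_smul] at hm

variable (M) in
/-- The identification `f ↦ t ∘ f` of `Hom_S(M, S)` with `Hom_R(M, R)` given by a linear form
`t : S → R` whose trace form `(s, u) ↦ t (s * u)` is perfect. -/
noncomputable def traceFormDualEquiv : Module.Dual S M ≃ₗ[R] Module.Dual R M :=
  LinearEquiv.ofBijective
    { toFun := fun f => t ∘ₗ f.restrictScalars R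
      map_add' := fun _ _ => LinearMap.ext fun _ => map_add t _ _
      map_smul' := fun _ _ => LinearMap.ext fun _ => map_smul t _ _ }
    ⟨fun f f' h => LinearMap.ext fun m => eq_of_forall_traceForm_eq ht fun u => by
        have hum : t (f (u • m)) = t (f' (u • m)) := LinearMap.congr_fun h (u • m)
        simpa only [map_smul, smul_eq_mul, mul_comm u] using hum,
      fun g => (exists_linearMap_traceForm_eq ht g).imp fun _ => LinearMap.ext⟩

include ht in
variable (M) in
/- Both bidualities become `m ↦ (f ↦ t (f m))` in `Hom_R(Hom_S(M, S), R)`. -/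
theorem isReflexive_iff_of_traceForm : Module.IsReflexive S M ↔ Module.IsReflexive R M := by
  have hsq : traceFormDualEquiv ht (Module.Dual S M) ∘ Module.Dual.eval S M =
    (traceFormDualEquiv ht M).dualMap ∘ Module.Dual.eval R M := rfl
  have hS := EquivLike.comp_bijective (Module.Dual.eval S M)
    (traceFormDualEquiv ht (Module.Dual S M))
  have hR := EquivLike.comp_bijective (Module.Dual.eval R M) (traceFormDualEquiv ht M).dualMap
  rw [hsq] at hS
  exact ⟨fun h => ⟨hR.1 (hS.2 h.1)⟩, fun h => ⟨hS.1 (hR.2 h.1)⟩⟩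

end TraceForm

section FractionalSubmodule

variable {A Q : Type u} [CommRing A] [CommRing Q] [Algebra A Q] [IsFractionRing A Q]

lemma linearMap_apply_mul_comm {I : Submodule A Q} (f : I →ₗ[A] Q) (y z : I) :
    f y * z = f z * y := by
  obtain ⟨a, b, d, ha, hb⟩ := IsLocalization.surj₂ A⁰ Q (y : Q) z
  have key : b • y = a • z := by
    refine Subtype.ext ?_
    rw [Submodule.coe_smul, Submodule.coe_smul, Algebra.smul_def, Algebra.smul_def, ← ha, ← hb]
    ring
  have hf := congrArg f key
  rw [map_smul, map_smul, Algebra.smul_def, Algebra.smul_def, ← ha, ← hb] at hf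
  exact (IsLocalization.map_units Q d).mul_left_cancel (by linear_combination hf)

/-- The canonical map from `(J :_Q I)` to `Hom_A(I, J)`, which takes `a` to multiplication by
`a`. -/
def divToHom (I J : Submodule A Q) : ↥(J / I) →ₗ[A] I →ₗ[A] J where
  toFun a := (LinearMap.mulLeft A (a : Q)).restrict (Submodule.mem_div_iff_forall_mul_mem.1 a.2)
  map_add' a b := LinearMap.ext fun y => Subtype.ext (add_mul (a : Q) b y)
  map_smul' r a := LinearMap.ext fun y => Subtype.ext (smul_mul_assoc r (a : Q) y)

lemma divToHom_bijective {I J : Submodule A Q} (hI : ∃ w ∈ I, IsUnit w) :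
    Function.Bijective (divToHom I J) := by
  obtain ⟨_, hw, w, rfl⟩ := hI
  refine ⟨fun a b h => ?_, fun f => ?_⟩
  · have hab : (a : Q) * w = b * w := congrArg Subtype.val (LinearMap.congr_fun h ⟨w, hw⟩)
    exact Subtype.ext (w.isUnit.mul_right_cancel hab)
  · obtain ⟨a, ha⟩ : ∃ a : Q, ∀ y : I, a * y = f y := by
      refine ⟨f ⟨w, hw⟩ * ↑w⁻¹, fun y => ?_⟩
      have hy : (f ⟨w, hw⟩ : Q) * y = f y * w :=
        linearMap_apply_mul_comm (J.subtype ∘ₗ f) ⟨w, hw⟩ y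
      rw [mul_right_comm, hy, Units.mul_inv_cancel_right]
    exact ⟨⟨a, Submodule.mem_div_iff_forall_mul_mem.2 fun y hy => ha ⟨y, hy⟩ ▸ (f ⟨y, hy⟩).2⟩,
      LinearMap.ext fun y => Subtype.ext (ha y)⟩

variable (A Q) in
/-- The identification of `A` with its image in its total ring of fractions. -/
noncomputable def ringEquivOne : A ≃ₗ[A] (1 : Submodule A Q) :=
  LinearEquiv.ofInjective (Algebra.linearMap A Q) (IsFractionRing.injective A Q) ≪≫ₗ
    LinearEquiv.ofEq _ _ Submodule.one_eq_range.symm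

/-- The dual of `I`, realized as the fractional submodule `(A :_Q I)`. -/
noncomputable def dualEquivOneDiv {I : Submodule A Q} (hI : ∃ w ∈ I, IsUnit w) :
    Module.Dual A I ≃ₗ[A] ↥(1 / I) :=
  (LinearEquiv.refl A I).arrowCongr (ringEquivOne A Q) ≪≫ₗ
    (LinearEquiv.ofBijective _ (divToHom_bijective hI)).symm

lemma dualEquivOneDiv_mul {I : Submodule A Q} (hI : ∃ w ∈ I, IsUnit w) (f : Module.Dual A I)
    (y : I) : (dualEquivOneDiv hI f : Q) * y = algebraMap A Q (f y) :=
  congrArg Subtype.val (LinearMap.congr_fun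
    ((LinearEquiv.ofBijective _ (divToHom_bijective hI)).apply_symm_apply _) y)

lemma exists_algebraMap_mem_one_div {I : Submodule A Q} (hI : I.FG) :
    ∃ d ∈ A⁰, algebraMap A Q d ∈ 1 / I := by
  obtain ⟨d, hd, hdI⟩ := FractionalIdeal.isFractional_of_fg (S := A⁰) hI
  refine ⟨d, hd, Submodule.mem_div_iff_forall_mul_mem.2 fun y hy => ?_⟩
  rw [← Algebra.smul_def]
  exact Submodule.mem_one.2 (hdI y hy)

lemma one_div_one_div_of_isReflexive {I : Submodule A Q} (hfg : I.FG) (hI : ∃ w ∈ I, IsUnit w)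
    [Module.IsReflexive A I] : 1 / (1 / I) = I := by
  refine le_antisymm (fun a ha => ?_) (Submodule.le_div_iff.2 fun y hy b hb =>
    mul_comm y b ▸ Submodule.mem_div_iff_forall_mul_mem.1 hb y hy)
  obtain ⟨d, hd, hdI⟩ := exists_algebraMap_mem_one_div hfg
  let φ : Module.Dual A (Module.Dual A I) :=
    (ringEquivOne A Q).symm.toLinearMap ∘ₗ divToHom (1 / I) 1 ⟨a, ha⟩ ∘ₗ
      (dualEquivOneDiv hI).toLinearMap
  obtain ⟨y, hy⟩ := (Module.bijective_dual_eval A I).2 φ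
  suffices a = y from this ▸ y.2
  obtain ⟨f, hf⟩ := (dualEquivOneDiv hI).surjective ⟨algebraMap A Q d, hdI⟩
  have hφ : algebraMap A Q (φ f) = a * dualEquivOneDiv hI f :=
    congrArg Subtype.val ((ringEquivOne A Q).apply_symm_apply _)
  rw [← hy, Module.Dual.eval_apply, ← dualEquivOneDiv_mul hI, hf, mul_comm] at hφ
  exact ((IsLocalization.map_units Q (⟨d, hd⟩ : A⁰)).mul_right_cancel hφ).symm

end FractionalSubmodule

namespace IsOneDimCohenMacaulay

variable {A Q : Type u} [CommRing A] [IsOneDimCohenMacaulay A] [CommRing Q] [Algebra A Q]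
  [IsFractionRing A Q]

lemma exists_mem_iff_mul_mem_span_singleton {n : Ideal A} [n.IsMaximal] {x : A} (hxn : x ∈ n)
    (hx : IsRegular x) : ∃ s, ∀ r, r ∈ n ↔ r * s ∈ Ideal.span {x} := by
  have hass : n ∈ associatedPrimes A (A ⧸ Ideal.span {x}) := by
    apply Module.associatedPrimes.minimalPrimes_annihilator_subset_associatedPrimes
    rw [Ideal.annihilator_quotient]
    exact mem_minimalPrimes_span_singleton hxn hx
  obtain ⟨-, z, hz⟩ := isAssociatedPrime_iff.1 hass
  obtain ⟨s, rfl⟩ := Ideal.Quotient.mk_surjective z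
  refine ⟨s, fun r => ?_⟩
  rw [hz, Submodule.mem_colon_singleton, Submodule.mem_bot, ← Ideal.Quotient.eq_zero_iff_mem,
    map_mul]
  rfl

/- If `J` lies in a maximal ideal `n`, then `n` is the annihilator of some `s` modulo a regular
element `x`, so `s / x` lies in `1 / J` but not in `A`. -/
lemma eq_one_of_one_div_le_one {J : Submodule A Q} (hJ : J ≤ 1) (hJ' : 1 / J ≤ 1) : J = 1 := by
  refine le_antisymm hJ (Submodule.one_le.2 (by_contra fun h1 => ?_))
  have hne : J.comap (Algebra.linearMap A Q) ≠ ⊤ := fun h =>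
    h1 (by simpa using (Ideal.eq_top_iff_one _).1 h)
  obtain ⟨n, hn, hJn⟩ := Ideal.exists_le_maximal _ hne
  obtain ⟨x, hxn, hx⟩ := (isMaximal_iff n).1 hn
  obtain ⟨s, hs⟩ := exists_mem_iff_mul_mem_span_singleton hxn hx
  obtain ⟨u, hu⟩ := IsLocalization.map_units Q (⟨x, hx.mem_nonZeroDivisors⟩ : A⁰)
  have hsx (r v : A) (hv : v * x = r * s) :
      algebraMap A Q s * ↑u⁻¹ * algebraMap A Q r = algebraMap A Q v := by
    rw [mul_right_comm, Units.mul_inv_eq_iff_eq_mul, hu, ← map_mul, ← map_mul, hv, mul_comm]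
  have hmem : algebraMap A Q s * ↑u⁻¹ ∈ 1 / J :=
    Submodule.mem_div_iff_forall_mul_mem.2 fun y hy => by
      obtain ⟨r, rfl⟩ := Submodule.mem_one.1 (hJ hy)
      obtain ⟨v, hv⟩ := Ideal.mem_span_singleton'.1 ((hs r).1 (hJn hy))
      exact Submodule.mem_one.2 ⟨v, (hsx r v hv).symm⟩
  obtain ⟨v, hv⟩ := Submodule.mem_one.1 (hJ' hmem)
  refine hn.ne_top ((Ideal.eq_top_iff_one n).2 ((hs 1).2 (Ideal.mem_span_singleton'.2 ⟨v, ?_⟩)))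
  refine IsFractionRing.injective A Q ?_
  rw [map_mul, hv, one_mul, mul_assoc, ← hu, Units.inv_mul, mul_one]

theorem isUnit_of_isReflexive {I : Submodule A Q} (hfg : I.FG) (hI : ∃ w ∈ I, IsUnit w)
    [Module.IsReflexive A I] (h : I / I = 1) : IsUnit I := by
  refine .of_mul_eq_one (1 / I) (eq_one_of_one_div_le_one Submodule.mul_one_div_le_one ?_)
  have hle : 1 / (I * (1 / I)) * I ≤ I :=
    calc 1 / (I * (1 / I)) * I ≤ 1 / (1 / I) := by
          rw [Submodule.le_div_iff_mul_le, mul_assoc, ← Submodule.le_div_iff_mul_le]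
      _ = I := one_div_one_div_of_isReflexive hfg hI
  exact (Submodule.le_div_iff_mul_le.2 hle).trans h.le

end IsOneDimCohenMacaulay

lemma nonempty_linearEquiv_of_isUnit {A Q : Type u} [CommRing A] [CommRing Q] [Algebra A Q]
    [FaithfulSMul A Q] [Finite (MaximalSpectrum A)] {I : Submodule A Q} (hI : IsUnit I) :
    Nonempty (I ≃ₗ[A] A) := by
  obtain ⟨I, rfl⟩ := hI
  exact Module.Invertible.free_iff_linearEquiv.1 inferInstance

section BirationalExtension

variable {R Q : Type u} [CommRing R] [CommRing Q] [Algebra R Q] [IsFractionRing R Q]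

instance isTorsionFree_fractionRing : Module.IsTorsionFree R Q where
  isSMulRegular d hd := by
    have hd' : IsRegular (algebraMap R Q d) :=
      (IsLocalization.map_units Q (⟨d, hd.mem_nonZeroDivisors⟩ : R⁰)).isRegular
    simpa only [IsSMulRegular, IsLeftRegular, Algebra.smul_def] using hd'.left

variable {S : Subalgebra R Q}

lemma exists_smul_eq_algebraMap (s : S) : ∃ d : R, IsRegular d ∧ ∃ r, d • s = algebraMap R S r := by
  obtain ⟨⟨r, d⟩, hr⟩ := IsLocalization.surj R⁰ (s : Q)
  refine ⟨d, isRegular_iff_mem_nonZeroDivisors.2 d.2, r, Subtype.ext ?_⟩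
  rw [SetLike.val_smul, Algebra.smul_def, mul_comm]
  exact hr

lemma isRegular_algebraMap {d : R} (hd : IsRegular d) : IsRegular (algebraMap R S d) := by
  rw [← isLeftRegular_iff_isRegular]
  simpa only [IsSMulRegular, IsLeftRegular, Algebra.smul_def] using hd.isSMulRegular (M := S)

instance isFractionRing_subalgebra : IsFractionRing S Q where
  map_units y := by
    suffices (y : Q) ∈ Q⁰ by rwa [IsFractionRing.nonZeroDivisors_eq_isUnit R Q] at this
    refine mem_nonZeroDivisors_iff_right.2 fun z hz => ?_
    obtain ⟨⟨r, d⟩, hr⟩ := IsLocalization.surj R⁰ z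
    have hry : algebraMap R S r * y = 0 := Subtype.ext <| by
      change algebraMap R Q r * y = 0
      rw [← hr, mul_right_comm, hz, zero_mul]
    have hr0 : algebraMap R Q r = 0 :=
      congrArg Subtype.val (mem_nonZeroDivisors_iff_right.1 y.2 _ hry)
    rwa [hr0, (IsLocalization.map_units Q d).mul_left_eq_zero] at hr
  surj z := by
    obtain ⟨⟨r, d⟩, hr⟩ := IsLocalization.surj R⁰ z
    exact ⟨⟨algebraMap R S r, algebraMap R S d, (isRegular_algebraMap
      (isRegular_iff_mem_nonZeroDivisors.2 d.2)).mem_nonZeroDivisors⟩, hr⟩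
  exists_of_eq h := ⟨1, by rw [Subtype.ext h]⟩

lemma linearMap_ext_one {N : Type u} [AddCommGroup N] [Module R N] [Module.IsTorsionFree R N]
    {f g : S →ₗ[R] N} (h : f 1 = g 1) : f = g := by
  ext s
  obtain ⟨d, hd, r, hr⟩ := exists_smul_eq_algebraMap s
  refine hd.isSMulRegular (M := N) ?_
  change d • f s = d • g s
  rw [← map_smul, ← map_smul, hr, Algebra.algebraMap_eq_smul_one, map_smul, map_smul, h]

instance compatibleSMul_of_isTorsionFree {M N : Type u} [AddCommGroup M] [Module R M] [Module S M]
    [IsScalarTower R S M] [AddCommGroup N] [Module R N] [Module S N] [IsScalarTower R S N]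
    [Module.IsTorsionFree R N] : LinearMap.CompatibleSMul M N S R where
  map_smul f s m := by
    have h : f ∘ₗ (LinearMap.toSpanSingleton S M m).restrictScalars R =
        (LinearMap.toSpanSingleton S N (f m)).restrictScalars R := linearMap_ext_one (by simp)
    exact LinearMap.congr_fun h s

instance isOneDimCohenMacaulay_subalgebra [IsOneDimCohenMacaulay R] [Module.Finite R S] :
    IsOneDimCohenMacaulay S where
  __ := IsNoetherianRing.of_finite R S
  isMaximal_iff q _ := by
    have hcomap : q.IsMaximal ↔ (q.comap (algebraMap R S)).IsMaximal :=
      ⟨fun _ => Ideal.isMaximal_comap_of_isIntegral_of_isMaximal q,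
        Ideal.isMaximal_of_isIntegral_of_isMaximal_comap q⟩
    rw [hcomap, IsOneDimCohenMacaulay.isMaximal_iff]
    constructor
    · rintro ⟨x, hxq, hx⟩
      exact ⟨algebraMap R S x, hxq, isRegular_algebraMap hx⟩
    · rintro ⟨y, hyq, hy⟩
      obtain ⟨d, hd, r, hr⟩ := exists_smul_eq_algebraMap y
      rw [Algebra.smul_def] at hr
      refine ⟨r, Ideal.mem_comap.2 (hr ▸ q.mul_mem_left _ hyq), ?_⟩
      have hinj : Function.Injective (algebraMap R S) :=
        .of_comp (f := S.val) (IsFractionRing.injective R Q)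
      exact isRegular_iff_mem_nonZeroDivisors.2 <| mem_nonZeroDivisors_of_injective hinj <|
        hr ▸ ((isRegular_algebraMap hd).mul hy).mem_nonZeroDivisors

end BirationalExtension

lemma finite_maximalSpectrum (R S : Type u) [CommRing R] [CommRing S] [Algebra R S]
    [Module.Finite R S] [Finite (MaximalSpectrum R)] : Finite (MaximalSpectrum S) := by
  let f : MaximalSpectrum S → MaximalSpectrum R := fun n =>
    ⟨n.asIdeal.under R, have := n.isMaximal; inferInstance⟩
  refine Set.finite_univ_iff.1 (Set.Finite.of_finite_fibers f (Set.toFinite _) fun m _ => ?_)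
  refine ((Algebra.QuasiFinite.finite_primesOver (S := S) m.asIdeal).preimage
    (fun _ _ _ _ => MaximalSpectrum.ext)).subset fun n hn => ?_
  exact ⟨n.isMaximal.isPrime, ⟨congrArg MaximalSpectrum.asIdeal hn.2.symm⟩⟩

section Conductor

variable {R Q : Type u} [CommRing R] [CommRing Q] [Algebra R Q] (S : Subalgebra R Q)

/-- The conductor `(R :_Q S)` as an `S`-submodule of `Q`; as `R`-submodules of `Q`,
`fractionalConductor S` and `1 / Subalgebra.toSubmodule S` agree definitionally. -/
def fractionalConductor : Submodule S Q where
  __ := 1 / Subalgebra.toSubmodule S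
  smul_mem' s a ha := Submodule.mem_div_iff_forall_mul_mem.2 fun b hb => by
    rw [Subalgebra.smul_def, smul_eq_mul, mul_right_comm, mul_comm]
    exact Submodule.mem_div_iff_forall_mul_mem.1 ha _ (S.mul_mem s.2 hb)

variable {S} in
lemma mem_fractionalConductor {a : Q} :
    a ∈ fractionalConductor S ↔ ∀ s ∈ S, a * s ∈ (1 : Submodule R Q) :=
  Submodule.mem_div_iff_forall_mul_mem

variable [IsFractionRing R Q]

/-- The identification of the conductor ideal of `R` with its image in `Q`. -/
noncomputable def birationalConductorEquiv :
    birationalConductor S ≃ₗ[R] fractionalConductor S :=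
  Submodule.equivMapOfInjective _ (IsFractionRing.injective R Q) (birationalConductor S) ≪≫ₗ
    LinearEquiv.ofEq _ (1 / Subalgebra.toSubmodule S) (Submodule.map_comap_eq_self fun a ha => by
      simpa only [← Submodule.one_eq_range, mul_one] using mem_fractionalConductor.1 ha 1 S.one_mem)

/-- The identification of the dual of `S` with its conductor. -/
noncomputable def dualEquivConductor : Module.Dual R S ≃ₗ[R] fractionalConductor S :=
  dualEquivOneDiv (I := Subalgebra.toSubmodule S) ⟨1, S.one_mem, isUnit_one⟩

lemma isReflModule_fractionalConductor [IsNoetherianRing R] [Module.IsReflexive R S] :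
    IsReflModule R (fractionalConductor S) :=
  ⟨.equiv (birationalConductorEquiv S), Module.equiv (dualEquivConductor S)⟩

lemma moduleTrace_le_birationalConductor (M : Type u) [AddCommGroup M] [Module R M] [Module S M]
    [IsScalarTower R S M] : moduleTrace R M ≤ birationalConductor S := by
  refine iSup_le fun f => ?_
  rintro _ ⟨m, rfl⟩
  refine mem_fractionalConductor.2 fun s hs => Submodule.mem_one.2 ⟨f ((⟨s, hs⟩ : S) • m), ?_⟩
  rw [mul_comm]
  exact (Algebra.linearMap R Q ∘ₗ f).map_smul_of_tower (⟨s, hs⟩ : S) m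

variable {S}

lemma exists_module_dual {M : Type u} [AddCommGroup M] [Module R M]
    (h : moduleTrace R M ≤ birationalConductor S) :
    ∃ _ : Module S (Module.Dual R M), IsScalarTower R S (Module.Dual R M) := by
  let ι : fractionalConductor S →ₗ[R] R :=
    (birationalConductor S).subtype ∘ₗ (birationalConductorEquiv S).symm.toLinearMap
  have hι : Function.Injective ι :=
    Subtype.val_injective.comp (birationalConductorEquiv S).symm.injective
  let e : (M →ₗ[R] fractionalConductor S) ≃ₗ[R] Module.Dual R M :=
    LinearEquiv.ofBijective (LinearMap.llcomp R M _ R ι)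
      ⟨fun g g' hg => LinearMap.ext fun m => hι (LinearMap.congr_fun hg m), fun f =>
        ⟨(birationalConductorEquiv S).toLinearMap ∘ₗ f.codRestrict (birationalConductor S)
            fun m => h (Submodule.mem_iSup_of_mem f (LinearMap.mem_range_self f m)),
          LinearMap.ext fun m => congrArg Subtype.val
            ((birationalConductorEquiv S).symm_apply_apply _)⟩⟩
  exact ⟨e.symm.toAddEquiv.module S, e.symm.isScalarTower S⟩

theorem exists_module_of_moduleTrace_le {M : Type u} [AddCommGroup M] [Module R M]
    [Module.IsReflexive R M] (h : moduleTrace R M ≤ birationalConductor S) :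
    ∃ _ : Module S M, IsScalarTower R S M := by
  obtain ⟨_, _⟩ := exists_module_dual h
  obtain ⟨_, _⟩ := exists_module_dual (moduleTrace_le_birationalConductor S (Module.Dual R M))
  let e := Module.evalEquiv R M
  exact ⟨e.toAddEquiv.module S, e.isScalarTower S⟩

lemma module_ext_of_isTorsionFree {M : Type u} [AddCommGroup M] [Module R M]
    [Module.IsTorsionFree R M] (i₁ i₂ : Module S M) (h₁ : letI := i₁; IsScalarTower R S M)
    (h₂ : letI := i₂; IsScalarTower R S M) : i₁ = i₂ :=
  Module.ext' i₁ i₂ <|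
    (@compatibleSMul_of_isTorsionFree R Q _ _ _ _ S M M _ _ i₁ h₁ _ _ i₂ h₂ _).map_smul LinearMap.id

lemma traceForm_bijective (e : S ≃ₗ[R] Module.Dual R S) :
    Function.Bijective ((LinearMap.mul R S).compr₂ (e 1)) := by
  have h : (LinearMap.mul R S).compr₂ (e 1) = e :=
    linearMap_ext_one (LinearMap.ext fun u => congrArg (e 1) (one_mul u))
  exact h ▸ e.bijective

section Finite

variable [Module.Finite R S]

variable (S) in
lemma exists_mem_birationalConductor : ∃ d ∈ birationalConductor S, d ∈ R⁰ := by
  have hfg : (Subalgebra.toSubmodule S).FG := Module.Finite.iff_fg.1 ‹Module.Finite R S›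
  obtain ⟨d, hd, hdS⟩ := exists_algebraMap_mem_one_div hfg
  exact ⟨d, hdS, hd⟩

variable (S) in
lemma exists_isUnit_mem_fractionalConductor : ∃ w ∈ fractionalConductor S, IsUnit w := by
  obtain ⟨d, hdS, hd⟩ := exists_mem_birationalConductor S
  exact ⟨algebraMap R Q d, hdS, IsLocalization.map_units Q (⟨d, hd⟩ : R⁰)⟩

lemma one_div_div_self_of_isReflexive [Module.IsReflexive R S] :
    1 / Subalgebra.toSubmodule S / (1 / Subalgebra.toSubmodule S) = Subalgebra.toSubmodule S := by
  have : Module.IsReflexive R (Subalgebra.toSubmodule S) := ‹Module.IsReflexive R S›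
  have h1 : 1 / Subalgebra.toSubmodule S ≤ 1 := fun a ha => by
    simpa only [mul_one] using mem_fractionalConductor.1 ha 1 S.one_mem
  refine le_antisymm ?_ (Submodule.le_div_iff.2 fun s hs a ha =>
    (fractionalConductor S).smul_mem ⟨s, hs⟩ ha)
  calc 1 / Subalgebra.toSubmodule S / (1 / Subalgebra.toSubmodule S)
      ≤ 1 / (1 / Subalgebra.toSubmodule S) := Submodule.le_div_iff_mul_le.2
        ((Submodule.le_div_iff_mul_le.1 le_rfl).trans h1)
    _ = Subalgebra.toSubmodule S :=
        one_div_one_div_of_isReflexive (Module.Finite.iff_fg.1 ‹Module.Finite R S›)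
          ⟨1, S.one_mem, isUnit_one⟩

lemma fractionalConductor_div_self [Module.IsReflexive R S] :
    fractionalConductor S / fractionalConductor S = 1 := by
  ext a
  have h : (∀ y ∈ fractionalConductor S, a * y ∈ fractionalConductor S) ↔ a ∈ S :=
    Submodule.mem_div_iff_forall_mul_mem.symm.trans
      (SetLike.ext_iff.1 one_div_div_self_of_isReflexive a)
  simpa [Submodule.mem_div_iff_forall_mul_mem] using h

variable (S) in
/-- When `S` is reflexive over `R`, it is the endomorphism ring of its conductor. -/
noncomputable def endConductorEquiv [Module.IsReflexive R S] :
    S ≃ₗ[R] (fractionalConductor S →ₗ[R] fractionalConductor S) :=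
  LinearEquiv.ofEq (Subalgebra.toSubmodule S) _ one_div_div_self_of_isReflexive.symm ≪≫ₗ
    LinearEquiv.ofBijective _ (divToHom_bijective (exists_isUnit_mem_fractionalConductor S))

theorem nonempty_equiv_dual_of_isStableIdeal (hS : IsReflModule R S)
    (h : IsStableIdeal (birationalConductor S)) : Nonempty (S ≃ₗ[R] Module.Dual R S) := by
  obtain ⟨-, ⟨e⟩⟩ := h
  have := hS.2
  let eC := birationalConductorEquiv S
  exact ⟨endConductorEquiv S ≪≫ₗ eC.symm.arrowCongr eC.symm ≪≫ₗ e.symm ≪≫ₗ eC ≪≫ₗ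
    (dualEquivConductor S).symm⟩

section IsOneDimCohenMacaulay

variable [IsOneDimCohenMacaulay R]

theorem nonempty_equiv_dual_of_isReflexive [Finite (MaximalSpectrum R)] [Module.IsReflexive R S]
    [Module.IsReflexive S (fractionalConductor S)] : Nonempty (S ≃ₗ[R] Module.Dual R S) := by
  have := finite_maximalSpectrum R S
  have : Module.Finite R (fractionalConductor S) := .equiv (birationalConductorEquiv S)
  have : Module.Finite S (fractionalConductor S) := .of_restrictScalars_finite R S _
  have hunit : IsUnit (fractionalConductor S) := IsOneDimCohenMacaulay.isUnit_of_isReflexive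
    (Module.Finite.iff_fg.1 this) (exists_isUnit_mem_fractionalConductor S)
    fractionalConductor_div_self
  obtain ⟨e⟩ := nonempty_linearEquiv_of_isUnit hunit
  exact ⟨e.symm.restrictScalars R ≪≫ₗ (dualEquivConductor S).symm⟩

theorem isReflModule_iff_of_equiv_dual (e : S ≃ₗ[R] Module.Dual R S) (M : Type u) [AddCommGroup M]
    [Module R M] [Module S M] [IsScalarTower R S M] :
    IsReflModule S M ↔ IsMCM S M ∧ IsReflModule R M := by
  have hrefl := isReflexive_iff_of_traceForm (traceForm_bijective e) M
  rw [IsOneDimCohenMacaulay.isMCM_iff]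
  constructor
  · rintro ⟨hfin, hM⟩
    exact ⟨⟨hfin, inferInstance⟩, .trans S M, hrefl.1 hM⟩
  · rintro ⟨⟨hfin, -⟩, -, hM⟩
    exact ⟨hfin, hrefl.2 hM⟩

theorem exists_isReflModule_iff_of_equiv_dual (e : S ≃ₗ[R] Module.Dual R S) (M : Type u)
    [AddCommGroup M] [Module R M] :
    (∃ _ : Module S M, IsScalarTower R S M ∧ IsReflModule S M) ↔
      IsReflModule R M ∧ moduleTrace R M ≤ birationalConductor S := by
  constructor
  · rintro ⟨_, _, hM⟩
    exact ⟨((isReflModule_iff_of_equiv_dual e M).1 hM).2, moduleTrace_le_birationalConductor S M⟩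
  · rintro ⟨⟨_, hM⟩, htr⟩
    obtain ⟨_, _⟩ := exists_module_of_moduleTrace_le htr
    exact ⟨_, ‹_›, .of_restrictScalars_finite R S M,
      (isReflexive_iff_of_traceForm (traceForm_bijective e) M).2 hM⟩

theorem isReflModule_and_isStableIdeal_of_equiv_dual (e : S ≃ₗ[R] Module.Dual R S) :
    IsReflModule R S ∧ IsStableIdeal (birationalConductor S) := by
  have hS : IsReflModule R S :=
    ((isReflModule_iff_of_equiv_dual e S).1 ⟨inferInstance, inferInstance⟩).2
  have := hS.2
  let eC := birationalConductorEquiv S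
  exact ⟨hS, exists_mem_birationalConductor S,
    ⟨eC ≪≫ₗ (dualEquivConductor S).symm ≪≫ₗ e.symm ≪≫ₗ endConductorEquiv S ≪≫ₗ
      eC.symm.arrowCongr eC.symm⟩⟩

variable [Finite (MaximalSpectrum R)]

theorem nonempty_equiv_dual_of_isReflModule_iff
    (h : ∀ (M : Type u) [AddCommGroup M] [Module R M] [Module S M] [IsScalarTower R S M],
      IsReflModule S M ↔ IsMCM S M ∧ IsReflModule R M) :
    Nonempty (S ≃ₗ[R] Module.Dual R S) := by
  have := ((h S).1 ⟨inferInstance, inferInstance⟩).2.2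
  have hC := isReflModule_fractionalConductor S
  have := hC.1
  have hCM : IsMCM S (fractionalConductor S) :=
    (IsOneDimCohenMacaulay.isMCM_iff _).2 ⟨.of_restrictScalars_finite R S _, inferInstance⟩
  have := ((h (fractionalConductor S)).2 ⟨hCM, hC⟩).2
  exact nonempty_equiv_dual_of_isReflexive

theorem nonempty_equiv_dual_of_exists_isReflModule_iff
    (h : ∀ (M : Type u) [AddCommGroup M] [Module R M],
      (∃ _ : Module S M, IsScalarTower R S M ∧ IsReflModule S M) ↔
        IsReflModule R M ∧ moduleTrace R M ≤ birationalConductor S) :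
    Nonempty (S ≃ₗ[R] Module.Dual R S) := by
  have := ((h S).1 ⟨inferInstance, inferInstance, inferInstance, inferInstance⟩).1.2
  obtain ⟨i, hi, hrefl⟩ := (h (fractionalConductor S)).2
    ⟨isReflModule_fractionalConductor S, moduleTrace_le_birationalConductor S _⟩
  have htower : IsScalarTower R S (fractionalConductor S) := inferInstance
  obtain rfl := module_ext_of_isTorsionFree i (fractionalConductor S).module hi htower
  have := hrefl.2
  exact nonempty_equiv_dual_of_isReflexive

end IsOneDimCohenMacaulay

end Finite

end Conductor

theorem theorem3p5_general {R Q : Type u} [CommRing R] [IsOneDimCohenMacaulay R]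
    [Finite (MaximalSpectrum R)] [CommRing Q] [Algebra R Q] [IsFractionRing R Q]
    (hGor : IsGenericallyGorenstein R) (S : Subalgebra R Q) [Module.Finite R S] :
    List.TFAE [
      ∀ (M : Type u) [AddCommGroup M] [Module R M] [Module S M] [IsScalarTower R S M],
        IsSyzygyMCM S M ↔ IsMCM S M ∧ IsSyzygyMCM R M,
      Nonempty (S ≃ₗ[R] Module.Dual R S),
      IsReflModule R S ∧ IsStableIdeal (birationalConductor S),
      ∀ (M : Type u) [AddCommGroup M] [Module R M],
        (∃ _ : Module S M, IsScalarTower R S M ∧ IsSyzygyMCM S M) ↔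
          IsReflModule R M ∧ moduleTrace R M ≤ birationalConductor S,
      ∀ (M : Type u) [AddCommGroup M] [Module R M] [Module S M] [IsScalarTower R S M],
        IsReflModule S M ↔ IsMCM S M ∧ IsReflModule R M] ∧
    (∀ (M : Type u) [AddCommGroup M] [Module R M], IsSyzygyMCM R M ↔ IsReflModule R M) ∧
    (∀ (M : Type u) [AddCommGroup M] [Module S M], IsSyzygyMCM S M ↔ IsReflModule S M) := by
  have : Module.Injective Q Q := hGor.injective_fractionRing
  have hR (M : Type u) [AddCommGroup M] [Module R M] : IsSyzygyMCM R M ↔ IsReflModule R M :=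
    IsOneDimCohenMacaulay.isSyzygyMCM_iff_isReflModule Q M
  have hS (M : Type u) [AddCommGroup M] [Module S M] : IsSyzygyMCM S M ↔ IsReflModule S M :=
    IsOneDimCohenMacaulay.isSyzygyMCM_iff_isReflModule Q M
  refine ⟨?_, hR, hS⟩
  simp only [hR, hS]
  tfae_have 1 ↔ 5 := Iff.rfl
  tfae_have 2 → 5 := fun ⟨e⟩ M _ _ _ _ => isReflModule_iff_of_equiv_dual e M
  tfae_have 5 → 2 := nonempty_equiv_dual_of_isReflModule_iff
  tfae_have 2 → 4 := fun ⟨e⟩ M _ _ => exists_isReflModule_iff_of_equiv_dual e M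
  tfae_have 4 → 2 := nonempty_equiv_dual_of_exists_isReflModule_iff
  tfae_have 2 → 3 := fun ⟨e⟩ => isReflModule_and_isStableIdeal_of_equiv_dual e
  tfae_have 3 → 2 := fun ⟨h, h'⟩ => nonempty_equiv_dual_of_isStableIdeal h h'
  tfae_finish

theorem theorem3p5 {R Q : Type u} [CommRing R] [IsLocalRing R] [CommRing Q] [Algebra R Q]
    [IsFractionRing R Q]
    (hCM : IsCohenMacaulayLocal R) (hdim : ringKrullDim R = 1) (hGor : IsGenericallyGorenstein R)
    (S : Subalgebra R Q) (hfin : Module.Finite R S) :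
    List.TFAE [
      -- (1) `ΩCM(S) = CM(S) ∩ ΩCM(R)`
      ∀ (M : Type u) [AddCommGroup M] [Module R M] [Module S M] [IsScalarTower R S M],
        IsSyzygyMCM S M ↔ IsMCM S M ∧ IsSyzygyMCM R M,
      -- (2) `S ≅ Hom_R(S, R)`
      Nonempty (S ≃ₗ[R] Module.Dual R S),
      -- (3) `S ∈ refl(R)` and the conductor is stable
      IsReflModule R S ∧ IsStableIdeal (birationalConductor S),
      -- (4) `ΩCM(S) = {M ∈ refl(R) : tr_R(M) ⊆ 𝔠_R(S)}`, as classes of `R`-modules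
      ∀ (M : Type u) [AddCommGroup M] [Module R M],
        (∃ _ : Module S M, IsScalarTower R S M ∧ IsSyzygyMCM S M) ↔
          IsReflModule R M ∧ moduleTrace R M ≤ birationalConductor S,
      -- (1) with `refl` in place of `ΩCM`: `refl(S) = CM(S) ∩ refl(R)`
      ∀ (M : Type u) [AddCommGroup M] [Module R M] [Module S M] [IsScalarTower R S M],
        IsReflModule S M ↔ IsMCM S M ∧ IsReflModule R M] ∧
    -- `ΩCM(R) = refl(R)`
    (∀ (M : Type u) [AddCommGroup M] [Module R M], IsSyzygyMCM R M ↔ IsReflModule R M) ∧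
    -- `ΩCM(S) = refl(S)`
    (∀ (M : Type u) [AddCommGroup M] [Module S M], IsSyzygyMCM S M ↔ IsReflModule S M) := by
  have := hCM.isOneDimCohenMacaulay hdim
  exact theorem3p5_general hGor S
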